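/- Let $G$ be an abelian group (written multiplicatively, with identity $e$). A ternary relation $R$ on $G$ is a cyclic order, and $(G,R)$ is a cyclically ordered group, if: $R(g_1,g_2,g_3)$ implies that $g_1,g_2,g_3$ are pairwise distinct; $R(g_1,g_2,g_3)$ implies $R(g_2,g_3,g_1)$; for each $g\in G$, $R(g,\cdot,\cdot)$ is a strict linear order on $G\setminus\{g\}$; and $R(g_1,g_2,g_3)$ implies $R(hg_1h',hg_2h',hg_3h')$ for all $h,h'\in G$. Let $\mathbb{U}$ be the group of complex numbers of modulus $1$, cyclically ordered by: $R(e^{i\theta_1},e^{i\theta_2},e^{i\theta_3})$, where $\theta_1,\theta_2,\theta_3\in[0,2\pi)$, if and only if $\theta_1<\theta_2<\theta_3$ or $\theta_2<\theta_3<\theta_1$ or $\theta_3<\theta_1<\theta_2$; let $T(\mathbb{U})$ be its torsion subgroup with the induced cyclic order. An abelian cyclically ordered group $(G,R)$ is called c-divisible if $G$ is divisible (for every integer $n\geq 1$ and $g\in G$ there is $h\in G$ with $h^n=g$) and $G$ contains a subgroup which, with the restriction of $R$, is isomorphic as a cyclically ordered group to $T(\mathbb{U})$. An open interval of $(G,R)$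 is a set of the form $\{h\in G : R(g,h,g')\}$ with $g\neq g'$ in $G$. A subset of $G$ is definable if it is defined by a first-order formula with one free variable, with parameters from $G$, in the language $\{\cdot,R,e,{}^{-1}\}$. The cyclically ordered group $(G,R)$ is called cyclically minimal if $G$ is infinite and every definable subset of $G$ is a finite union of singletons and open intervals. **Proposition.** Every c-divisible abelian cyclically ordered group is cyclically minimal. -/

import Mathlib

namespace CyclicallyOrderedGroup

/-- `R` is a cyclic order on the group `G`, i.e. `(G, R)` is a cyclically ordered group:
`R` is strict, cyclic, for each `g` the relation `R g · ·` is a (strict) linear order on `G \ {g}`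
(irreflexivity is part of `strict`), and `R` is compatible with left and right translations. -/
structure IsCyclicOrder {G : Type*} [Group G] (R : G → G → G → Prop) : Prop where
  strict : ∀ a b c, R a b c → a ≠ b ∧ b ≠ c ∧ c ≠ a
  cyclic : ∀ a b c, R a b c → R b c a
  trans : ∀ g a b c, R g a b → R g b c → R g a c
  total : ∀ g a b, a ≠ g → b ≠ g → a ≠ b → R g a b ∨ R g b a
  compatible : ∀ a b c h h', R a b c → R (h * a * h') (h * b * h') (h * c * h')

/-- The standard cyclic order of the group `𝕌` of unimodular complex numbers: three points are
in relation iff their arguments in `[0, 2π)` are, up to a cyclic permutation, increasing. -/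
def unitR (z₁ z₂ z₃ : Circle) : Prop :=
  ∃ θ₁ θ₂ θ₃ : ℝ, z₁ = Circle.exp θ₁ ∧ z₂ = Circle.exp θ₂ ∧ z₃ = Circle.exp θ₃ ∧
    ((0 ≤ θ₁ ∧ θ₁ < θ₂ ∧ θ₂ < θ₃ ∧ θ₃ < 2 * Real.pi) ∨
     (0 ≤ θ₂ ∧ θ₂ < θ₃ ∧ θ₃ < θ₁ ∧ θ₁ < 2 * Real.pi) ∨
     (0 ≤ θ₃ ∧ θ₃ < θ₁ ∧ θ₁ < θ₂ ∧ θ₂ < 2 * Real.pi))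

/-- `(G, R)` contains a subgroup c-isomorphic to the torsion subgroup `T(𝕌)` of `𝕌`
(with the cyclic order induced by that of `𝕌`). -/
def ContainsTorsionCircle {G : Type*} [Group G] (R : G → G → G → Prop) : Prop :=
  ∃ (H : Subgroup G) (f : CommGroup.torsion Circle ≃* H),
    ∀ a b c : CommGroup.torsion Circle,
      unitR (a : Circle) (b : Circle) (c : Circle) ↔ R (f a : G) (f b : G) (f c : G)

/-- `(G, R)` is c-divisible: `G` is divisible and contains a subgroup c-isomorphic to `T(𝕌)`. -/
def IsCDivisible {G : Type*} [Group G] (R : G → G → G → Prop) : Prop :=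
  (∀ n : ℕ, n ≠ 0 → ∀ g : G, ∃ h : G, h ^ n = g) ∧ ContainsTorsionCircle R

/-- Function symbols `·`, `⁻¹`, `e` of the language of cyclically ordered groups. -/
inductive Func : ℕ → Type
  | mul : Func 2
  | inv : Func 1
  | one : Func 0

/-- The ternary relation symbol `R` of the language of cyclically ordered groups. -/
inductive Rel : ℕ → Type
  | cyc : Rel 3

/-- The first-order language `{·, R, e, ⁻¹}` of cyclically ordered groups. -/
def lang : FirstOrder.Language.{0, 0} where
  Functions := Func
  Relations := Rel

/-- `(G, R)` as a first-order structure in the language of cyclically ordered groups. -/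
@[reducible]
def toStructure {G : Type*} [Group G] (R : G → G → G → Prop) : lang.Structure G where
  funMap := fun {n} (s : Func n) =>
    match n, s with
    | _, .mul => fun x => x 0 * x 1
    | _, .inv => fun x => (x 0)⁻¹
    | _, .one => fun _ => 1
  RelMap := fun {n} (s : Rel n) =>
    match n, s with
    | _, .cyc => fun x => R (x 0) (x 1) (x 2)

/-- `S` is a definable subset of `(G, R)`: it is defined by a first-order formula in one free
variable, with parameters from `G`. -/
def IsDefinable {G : Type*} [Group G] (R : G → G → G → Prop) (S : Set G) : Prop :=
  letI := toStructure R
  (Set.univ : Set G).Definable₁ lang S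

/-- The open interval `I(g, g')`. -/
def interval {G : Type*} (R : G → G → G → Prop) (g g' : G) : Set G :=
  {h | R g h g'}

/-- `I` is an open interval of `(G, R)`: `I = I(g, g')` for some `g ≠ g'`. -/
def IsOpenInterval {G : Type*} (R : G → G → G → Prop) (I : Set G) : Prop :=
  ∃ g g' : G, g ≠ g' ∧ I = interval R g g'

/-- `(G, R)` is cyclically minimal: `G` is infinite and each definable subset of `G` is a finite
union of singletons and open intervals. -/
def IsCyclicallyMinimal {G : Type*} [Group G] (R : G → G → G → Prop) : Prop :=
  Infinite G ∧ ∀ S : Set G, IsDefinable R S →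
    ∃ F : Set (Set G), F.Finite ∧
      (∀ J ∈ F, (∃ g : G, J = {g}) ∨ IsOpenInterval R J) ∧ S = ⋃₀ F

end CyclicallyOrderedGroup

/-! Cutting the circle at `1` and counting turns unwinds `G` into a linearly ordered abelian group
`V = Unwound hR` with `V / ⟨turn⟩ = G`, elements of `G` corresponding to the box `[0, turn)`. The
roots of unity in `G` supply `n`-th roots of `turn` (`exists_nsmul_eq_turn`); with divisibility of
`G` this makes `V` divisible (`exists_zsmul_eq`). Over the box, an atomic formula is decided by the
signs of `f - k • turn` for affine `f` and integers `k`, and boundedness of `f` leaves finitely many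
`k` (`exists_finite_sign_sub_zsmul_turn`). Quantifiers are removed by Fourier–Motzkin elimination in
`V` (`exists_sign_eq_of_sign_eq`, `exists_finite_realize_iff`). A one-variable formula thus depends
only on the position of the variable relative to finitely many roots, which cut the circle into
points and intervals. -/

namespace CyclicallyOrderedGroup

/-! ### The linear order obtained by a cut at `1`. -/

variable {G : Type*} [CommGroup G] {R : G → G → G → Prop}

/-- The linear order on `G` with least element `1` obtained by cutting the cyclic order at `1`. -/
def CutLT (R : G → G → G → Prop) (a b : G) : Prop :=
  (a = 1 ∧ b ≠ 1) ∨ R 1 a b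

namespace IsCyclicOrder

variable (hR : IsCyclicOrder R)
include hR

theorem asymm {a b c : G} (h : R a b c) : ¬ R a c b := fun h' =>
  (hR.strict _ _ _ (hR.trans _ _ _ _ h h')).2.1 rfl

theorem mul_left {a b c : G} (k : G) (h : R a b c) : R (k * a) (k * b) (k * c) := by
  simpa using hR.compatible _ _ _ k 1 h

theorem cutLT_irrefl (a : G) : ¬ CutLT R a a := by
  rintro (⟨h, h'⟩ | h)
  · exact h' h
  · exact (hR.strict _ _ _ h).2.1 rfl

theorem cutLT_trans {a b c : G} (h : CutLT R a b) (h' : CutLT R b c) : CutLT R a c := by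
  rcases h with ⟨h1, h2⟩ | h <;> rcases h' with ⟨h3, h4⟩ | h'
  · exact Or.inl ⟨h1, h4⟩
  · exact Or.inl ⟨h1, (hR.strict _ _ _ h').2.2⟩
  · exact absurd h3 (hR.strict _ _ _ h).2.2
  · exact Or.inr (hR.trans _ _ _ _ h h')

theorem cutLT_trichotomy (a b : G) : CutLT R a b ∨ a = b ∨ CutLT R b a := by
  have := hR.total 1 a b
  unfold CutLT
  by_cases ha : a = 1 <;> by_cases hb : b = 1 <;> by_cases hab : a = b <;> simp_all

theorem not_cutLT_one (a : G) : ¬ CutLT R a 1 := by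
  rintro (⟨_, h'⟩ | h)
  · exact h' rfl
  · exact (hR.strict _ _ _ h).2.2 rfl

omit hR in
theorem one_cutLT {a : G} (ha : a ≠ 1) : CutLT R 1 a := Or.inl ⟨rfl, ha⟩

theorem cyc_of_cutLT {a b c : G} (h1 : CutLT R a b) (h2 : CutLT R b c) : R a b c := by
  rcases h1 with ⟨rfl, h1⟩ | h1 <;> rcases h2 with ⟨h3, h4⟩ | h2
  · exact absurd h3 h1
  · exact h2
  · exact absurd h3 (hR.strict _ _ _ h1).2.2
  · have hac := hR.strict _ _ _ (hR.trans _ _ _ _ h1 h2)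
    have hs1 := hR.strict _ _ _ h1
    refine (hR.total a b c hs1.2.1.symm hac.2.1.symm (hR.strict _ _ _ h2).2.1).resolve_right
      fun h3 => ?_
    have h4 := hR.trans b a c 1 (hR.cyclic _ _ _ (hR.cyclic _ _ _ h3)) (hR.cyclic _ _ _ h2)
    exact hR.asymm h4 (hR.cyclic _ _ _ (hR.cyclic _ _ _ h1))

theorem cutLT_chain_of {a b c : G} (h : R a b c) :
    (CutLT R a b ∧ CutLT R b c) ∨ (CutLT R b c ∧ CutLT R c a) ∨ (CutLT R c a ∧ CutLT R a b) := by
  have hs := hR.strict _ _ _ h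
  rcases hR.cutLT_trichotomy a b with h1 | h1 | h1
  · rcases hR.cutLT_trichotomy b c with h2 | h2 | h2
    · exact Or.inl ⟨h1, h2⟩
    · exact absurd h2 hs.2.1
    · rcases hR.cutLT_trichotomy a c with h3 | h3 | h3
      · exact absurd (hR.cyc_of_cutLT h3 h2) (hR.asymm h)
      · exact absurd h3.symm hs.2.2
      · exact Or.inr (Or.inr ⟨h3, h1⟩)
  · exact absurd h1 hs.1
  · rcases hR.cutLT_trichotomy b c with h2 | h2 | h2
    · rcases hR.cutLT_trichotomy a c with h3 | h3 | h3
      · exact absurd (hR.cyclic _ _ _ (hR.cyc_of_cutLT h1 h3)) (hR.asymm h)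
      · exact absurd h3.symm hs.2.2
      · exact Or.inr (Or.inl ⟨h2, h3⟩)
    · exact absurd h2 hs.2.1
    · exact absurd (hR.cyclic _ _ _ (hR.cyclic _ _ _ (hR.cyc_of_cutLT h2 h1))) (hR.asymm h)

theorem mul_cutLT_chain (k : G) {a b : G} (h : CutLT R a b) :
    a = 1 ∨ (CutLT R k (k * a) ∧ CutLT R (k * a) (k * b)) ∨
      (CutLT R (k * a) (k * b) ∧ CutLT R (k * b) k) ∨
      (CutLT R (k * b) k ∧ CutLT R k (k * a)) := by
  rcases h with ⟨h, _⟩ | h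
  · exact Or.inl h
  · exact Or.inr (hR.cutLT_chain_of (by simpa using hR.mul_left k h))

/-- Otherwise translating the triples `(1, x, y)` and `(1, x⁻¹, y⁻¹)` closes a cycle in the cut
order: `y x⁻¹ < x⁻¹ < y⁻¹ < x y⁻¹ < x < y < y x⁻¹`. -/
theorem inv_cutLT_inv {x y : G} (hx : x ≠ 1) (h : CutLT R x y) : CutLT R y⁻¹ x⁻¹ := by
  have key : ∀ {x y : G}, R 1 x y → R 1 (y * x⁻¹) x⁻¹ ∧ R 1 y⁻¹ (x * y⁻¹) := by
    intro x y h
    have h1 := hR.mul_left x⁻¹ h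
    have h2 := hR.mul_left y⁻¹ h
    simp only [mul_one, inv_mul_cancel] at h1 h2
    rw [mul_comm] at h1 
    rw [mul_comm y⁻¹ x] at h2
    refine ⟨?_, hR.cyclic _ _ _ (hR.cyclic _ _ _ h2)⟩
    have := hR.cyclic _ _ _ h1
    simpa [mul_comm] using this
  have h := h.resolve_left (fun h => hx h.1)
  have hs := hR.strict _ _ _ h
  refine Or.inr ((hR.total 1 _ _ (by simpa using hs.2.2) (by simpa using hx)
    (by simpa using hs.2.1.symm)).resolve_right fun h' => ?_)
  have h1 := key h
  have h2 := key h'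
  simp only [inv_inv] at h2
  have e : y⁻¹ * x = x * y⁻¹ := mul_comm _ _
  have e' : x⁻¹ * y = y * x⁻¹ := mul_comm _ _
  rw [e, e'] at h2
  have h3 := hR.trans _ _ _ _ h1.1 h'
  have h4 := hR.trans _ _ _ _ h3 h1.2
  have h5 := hR.trans _ _ _ _ h4 h2.1
  have h6 := hR.trans _ _ _ _ h5 h
  exact hR.asymm h6 h2.2

/-- When `g * h ≠ 1`, the product passes the origin iff `g⁻¹` precedes `h`, a condition symmetric in
`g` and `h` because inversion reverses the order. -/
theorem mul_cutLT_left_iff (g h : G) : CutLT R (g * h) g ↔ CutLT R (g * h) h := by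
  have key : ∀ g h : G, CutLT R (g * h) g → CutLT R (g * h) h := by
    intro g h hlt
    rcases hlt with ⟨h1, h2⟩ | hlt
    · refine Or.inl ⟨h1, ?_⟩
      rintro rfl
      exact h2 (by simpa using h1)
    · have hs := hR.strict _ _ _ hlt
      have h1 : R 1 g⁻¹ h := by
        have := hR.cyclic _ _ _ (hR.cyclic _ _ _ (hR.mul_left g⁻¹ hlt))
        simpa using this
      have h2 : CutLT R h⁻¹ g := by
        simpa using hR.inv_cutLT_inv (by simpa using hs.2.2) (Or.inr h1)
      have hh := hR.strict _ _ _ h1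
      have h3 : R 1 h⁻¹ g := h2.resolve_left (fun H => hh.2.2 (by simpa using H.1))
      have h4 := hR.cyclic _ _ _ (hR.mul_left h h3)
      right
      simpa [mul_comm] using h4
  exact ⟨key g h, fun H => by rw [mul_comm] at H ⊢; exact key h g H⟩

end IsCyclicOrder

end CyclicallyOrderedGroup
-- The carry cocycle and the unwound ordered group.
namespace CyclicallyOrderedGroup

variable {G : Type*} [CommGroup G] {R : G → G → G → Prop}

open Classical in
/-- The linear order `CutLT R` as a `LinearOrder`. -/
noncomputable abbrev IsCyclicOrder.cutOrder (hR : IsCyclicOrder R) : LinearOrder G where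
  le a b := ¬ CutLT R b a
  lt a b := CutLT R a b
  le_refl a := hR.cutLT_irrefl a
  le_trans a b c h h' h'' := by
    rcases hR.cutLT_trichotomy a b with h1 | rfl | h1
    · exact h' (hR.cutLT_trans h'' h1)
    · exact h' h''
    · exact h h1
  lt_iff_le_not_ge a b :=
    ⟨fun h => ⟨fun h' => hR.cutLT_irrefl _ (hR.cutLT_trans h h'), fun h' => h' h⟩,
      fun h => not_not.1 h.2⟩
  le_antisymm a b h h' := by
    rcases hR.cutLT_trichotomy a b with h1 | h1 | h1
    · exact absurd h1 h'
    · exact h1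
    · exact absurd h1 h
  le_total a b := by
    by_contra h
    rw [not_or, not_not, not_not] at h
    exact hR.cutLT_irrefl _ (hR.cutLT_trans h.1 h.2)
  toDecidableLE := fun _ _ => Classical.propDecidable _

open Classical in
/-- `carry R g h` is `1` if the product `g * h` passes the origin, and `0` otherwise. -/
noncomputable def carry (R : G → G → G → Prop) (g h : G) : ℤ :=
  if CutLT R (g * h) g then 1 else 0

namespace IsCyclicOrder

variable (hR : IsCyclicOrder R)
include hR

theorem carry_comm (g h : G) : carry R g h = carry R h g := by
  unfold carry
  congr 1
  rw [mul_comm h g, hR.mul_cutLT_left_iff]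

theorem carry_one_right (g : G) : carry R g 1 = 0 := by
  unfold carry
  rw [if_neg (by simpa using hR.cutLT_irrefl g)]

theorem carry_one_left (g : G) : carry R 1 g = 0 := by
  rw [hR.carry_comm, hR.carry_one_right]

/-- Translation by `k` keeps the order once carries are counted. Both the cocycle identity and the
compatibility of the order on `Unwound hR` rest on this. -/
theorem carry_lex (k : G) {a b : G} (h : CutLT R a b) :
    carry R k a < carry R k b ∨ (carry R k a = carry R k b ∧ CutLT R (k * a) (k * b)) := by
  let _ := hR.cutOrder
  have hb : k * b ≠ k := by
    intro h'
    rw [mul_eq_left] at h'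
    exact hR.not_cutLT_one a (h' ▸ h)
  have hb' : b ≠ 1 := fun h' => hR.not_cutLT_one a (h' ▸ h)
  have H := hR.mul_cutLT_chain k h
  unfold carry
  change a < b at h
  simp only [show ∀ x y : G, CutLT R x y ↔ x < y from fun _ _ => Iff.rfl] at H ⊢
  rcases H with rfl | ⟨h1, h2⟩ | ⟨h1, h2⟩ | ⟨h1, h2⟩
  · rw [mul_one, if_neg (lt_irrefl k)]
    rcases lt_or_gt_of_ne hb with h1 | h1
    · left; rw [if_pos h1]; norm_num
    · right; rw [if_neg h1.le.not_gt]; exact ⟨rfl, h1⟩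
  · right; rw [if_neg h1.le.not_gt, if_neg (h1.trans h2).le.not_gt]; exact ⟨rfl, h2⟩
  · right; rw [if_pos (h1.trans h2), if_pos h2]; exact ⟨rfl, h1⟩
  · left; rw [if_neg h2.le.not_gt, if_pos h1]; norm_num

omit hR in
theorem carry_of_cutLT {g h : G} (H : CutLT R (g * h) g) : carry R g h = 1 := if_pos H

omit hR in
theorem carry_of_not_cutLT {g h : G} (H : ¬ CutLT R (g * h) g) : carry R g h = 0 := if_neg H

omit hR in
theorem carry_lt_carry {g h g' h' : G} (H : carry R g h < carry R g' h') :
    carry R g h = 0 ∧ ¬ CutLT R (g * h) g ∧ carry R g' h' = 1 ∧ CutLT R (g' * h') g' := by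
  unfold carry at *
  split_ifs at * <;> simp_all

/-- `carry R h k` records whether `h * k` falls below `h`; translating that comparison by `g` with
`carry_lex` determines the other carries. -/
theorem carry_cocycle (g h k : G) :
    carry R g h + carry R (g * h) k = carry R h k + carry R g (h * k) := by
  let _ := hR.cutOrder
  have e : ∀ x y : G, CutLT R x y ↔ x < y := fun _ _ => Iff.rfl
  by_cases hk : k = 1
  · subst hk; simp [hR.carry_one_right]
  have hne : h * k ≠ h := by simpa using hk
  have hne' : g * (h * k) ≠ g * h := by simpa using hk
  rcases hR.cutLT_trichotomy h (h * k) with hlt | heq | hlt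
  · rw [carry_of_not_cutLT (g := h) (by rw [e] at *; order)]
    rcases hR.carry_lex g hlt with H | ⟨H, H'⟩
    · obtain ⟨h1, h2, h3, h4⟩ := carry_lt_carry H
      rw [h1, h3, carry_of_cutLT (by rw [mul_assoc]; rw [e] at *; order)]
    · rw [H, carry_of_not_cutLT (g := g * h) (by rw [mul_assoc]; rw [e] at *; order)]
      ring
  · exact absurd heq.symm hne
  · rw [carry_of_cutLT (g := h) hlt]
    rcases hR.carry_lex g hlt with H | ⟨H, H'⟩
    · obtain ⟨h1, h2, h3, h4⟩ := carry_lt_carry H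
      rw [h1, h3, carry_of_not_cutLT (by rw [mul_assoc]; rw [e] at *; order)]
    · rw [H, carry_of_cutLT (g := g * h) (by rw [mul_assoc]; exact H')]
      ring

end IsCyclicOrder

/-- The unwinding of a cyclically ordered group: the linearly ordered group `ℤ × G` with addition
twisted by the carry cocycle. -/
@[ext]
structure Unwound (hR : IsCyclicOrder R) where
  turns : ℤ
  pos : G

namespace Unwound

variable {hR : IsCyclicOrder R}

noncomputable instance : Zero (Unwound hR) := ⟨⟨0, 1⟩⟩
noncomputable instance : Add (Unwound hR) :=
  ⟨fun x y => ⟨x.turns + y.turns + carry R x.pos y.pos, x.pos * y.pos⟩⟩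
noncomputable instance : Neg (Unwound hR) :=
  ⟨fun x => ⟨-x.turns - carry R x.pos⁻¹ x.pos, x.pos⁻¹⟩⟩

@[simp] theorem zero_turns : (0 : Unwound hR).turns = 0 := rfl
@[simp] theorem zero_pos : (0 : Unwound hR).pos = 1 := rfl
theorem add_turns (x y : Unwound hR) :
    (x + y).turns = x.turns + y.turns + carry R x.pos y.pos := rfl
@[simp] theorem add_pos (x y : Unwound hR) : (x + y).pos = x.pos * y.pos := rfl
theorem neg_turns (x : Unwound hR) :
    (-x).turns = -x.turns - carry R x.pos⁻¹ x.pos := rfl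
@[simp] theorem neg_pos (x : Unwound hR) : (-x).pos = x.pos⁻¹ := rfl

noncomputable instance : AddCommGroup (Unwound hR) where
  add_assoc x y z := by
    ext
    · simp only [add_turns, add_pos]
      linarith [hR.carry_cocycle x.pos y.pos z.pos]
    · simp [mul_assoc]
  zero_add x := by ext <;> simp [add_turns, hR.carry_one_left]
  add_zero x := by ext <;> simp [add_turns, hR.carry_one_right]
  neg_add_cancel x := by
    ext
    · simp [add_turns, neg_turns]; ring
    · simp
  add_comm x y := by
    ext
    · simp only [add_turns, hR.carry_comm x.pos y.pos]; ring
    · simp [mul_comm]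
  nsmul := nsmulRec
  zsmul := zsmulRec

open Classical in
noncomputable instance : LinearOrder (Unwound hR) where
  lt x y := x.turns < y.turns ∨ (x.turns = y.turns ∧ CutLT R x.pos y.pos)
  le x y := x.turns < y.turns ∨ (x.turns = y.turns ∧ ¬ CutLT R y.pos x.pos)
  le_refl x := Or.inr ⟨rfl, hR.cutLT_irrefl _⟩
  le_trans x y z h h' := by
    rcases h with h | h <;> rcases h' with h' | h'
    · exact Or.inl (h.trans h')
    · exact Or.inl (h'.1 ▸ h)
    · exact Or.inl (h.1 ▸ h')
    · exact Or.inr ⟨h.1.trans h'.1, hR.cutOrder.le_trans _ _ _ h.2 h'.2⟩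
  lt_iff_le_not_ge x y := by
    have h1 := hR.cutOrder.lt_iff_le_not_ge x.pos y.pos
    change CutLT R x.pos y.pos ↔ ¬ CutLT R y.pos x.pos ∧ ¬ ¬ CutLT R x.pos y.pos at h1
    constructor
    · rintro (h | h)
      · exact ⟨Or.inl h, by rintro (h' | h') <;> omega⟩
      · refine ⟨Or.inr ⟨h.1, (h1.1 h.2).1⟩, ?_⟩
        rintro (h' | h')
        · omega
        · exact h'.2 h.2
    · rintro ⟨h | h, h'⟩
      · exact Or.inl h
      · by_contra h''
        exact h' (Or.inr ⟨h.1.symm, fun H => h'' (Or.inr ⟨h.1, H⟩)⟩)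
  le_antisymm x y h h' := by
    rcases h with h | h <;> rcases h' with h' | h'
    · omega
    · omega
    · omega
    · exact Unwound.ext h.1 (hR.cutOrder.le_antisymm _ _ h.2 h'.2)
  le_total x y := by
    rcases lt_trichotomy x.turns y.turns with h | h | h
    · exact Or.inl (Or.inl h)
    · rcases hR.cutOrder.le_total x.pos y.pos with h' | h'
      · exact Or.inl (Or.inr ⟨h, h'⟩)
      · exact Or.inr (Or.inr ⟨h.symm, h'⟩)
    · exact Or.inr (Or.inl h)
  toDecidableLE := fun _ _ => Classical.propDecidable _

theorem lt_def {x y : Unwound hR} :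
    x < y ↔ x.turns < y.turns ∨ (x.turns = y.turns ∧ CutLT R x.pos y.pos) := Iff.rfl

instance : IsOrderedAddMonoid (Unwound hR) := by
  have key : ∀ x y z : Unwound hR, x < y → z + x < z + y := by
    intro x y z h
    rw [lt_def] at h ⊢
    simp only [add_turns, add_pos]
    rcases h with h | ⟨h, h'⟩
    · by_cases hc : carry R z.pos y.pos < carry R z.pos x.pos
      · have hc' := hc
        obtain ⟨h1, h2, h3, h4⟩ := IsCyclicOrder.carry_lt_carry hc
        rw [h1, h3]
        by_cases h5 : x.turns + 1 < y.turns
        · left; omega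
        -- The larger carry of `x` cancels the one-turn gap, so positions decide: `z.pos * x.pos <
        -- z.pos ≤ z.pos * y.pos`.
        · right
          refine ⟨by omega, ?_⟩
          let _ := hR.cutOrder
          have e : ∀ x y : G, CutLT R x y ↔ x < y := fun _ _ => Iff.rfl
          rw [e] at *
          order
      · left; omega
    · rcases hR.carry_lex z.pos h' with H | H
      · left; omega
      · right; exact ⟨by omega, H.2⟩
  refine { add_le_add_left := fun a b h c => ?_ }
  rcases h.eq_or_lt with rfl | h
  · exact le_rfl
  · rw [add_comm a, add_comm b]
    exact (key _ _ _ h).le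

/-- The central positive element by which one turn of the circle translates. -/
def turn (hR : IsCyclicOrder R) : Unwound hR := ⟨1, 1⟩

theorem turn_pos : 0 < turn hR := Or.inl (by simp [turn])

theorem zsmul_turn (n : ℤ) : n • turn hR = ⟨n, 1⟩ := by
  have key : ∀ n : ℕ, n • turn hR = ⟨n, 1⟩ := by
    intro n
    induction n with
    | zero => simp; rfl
    | succ n ih =>
      rw [succ_nsmul, ih]
      ext <;> simp [add_turns, turn, hR.carry_one_left]
  obtain ⟨n, rfl | rfl⟩ := n.eq_nat_or_neg
  · simpa using key n
  · rw [neg_smul, natCast_zsmul, key]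
    ext <;> simp [neg_turns, hR.carry_one_right]

theorem add_zsmul_turn (x : Unwound hR) (n : ℤ) :
    x + n • turn hR = ⟨x.turns + n, x.pos⟩ := by
  rw [zsmul_turn]
  ext <;> simp [add_turns, hR.carry_one_right]

end Unwound

end CyclicallyOrderedGroup
-- Affine functions and elimination of one variable.
namespace CyclicallyOrderedGroup

open SignType

section Affine

variable {V : Type*} [AddCommGroup V] {ι κ : Type*}

/-- The group of affine functions with integer linear part on `ι → V`. -/
def affine (V ι : Type*) [AddCommGroup V] : AddSubgroup ((ι → V) → V) :=
  AddSubgroup.closure (Set.range (fun i v => v i) ∪ Set.range (fun c _ => c))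

theorem coord_mem_affine (i : ι) : (fun v : ι → V => v i) ∈ affine V ι :=
  AddSubgroup.subset_closure (Or.inl ⟨i, rfl⟩)

theorem const_mem_affine (c : V) : (fun _ : ι → V => c) ∈ affine V ι :=
  AddSubgroup.subset_closure (Or.inr ⟨c, rfl⟩)

/-- Separating one variable in an affine function. -/
theorem exists_zsmul_add_of_mem_affine (e : (κ → V) → V → ι → V)
    (he : ∀ i, (∃ j, ∀ v x, e v x i = v j) ∨ ∀ v x, e v x i = x)
    {f : (ι → V) → V} (hf : f ∈ affine V ι) :
    ∃ (a : ℤ) (g : (κ → V) → V), g ∈ affine V κ ∧ ∀ v x, f (e v x) = a • x + g v := by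
  induction hf using AddSubgroup.closure_induction with
  | mem f hf =>
    rcases hf with ⟨i, rfl⟩ | ⟨c, rfl⟩
    · rcases he i with ⟨j, hj⟩ | h
      · exact ⟨0, _, coord_mem_affine j, fun v x => by simp [hj]⟩
      · exact ⟨1, 0, zero_mem _, fun v x => by simp [h]⟩
    · exact ⟨0, _, const_mem_affine c, fun v x => by simp⟩
  | zero => exact ⟨0, 0, zero_mem _, by simp⟩
  | add f f' _ _ ih ih' =>
    obtain ⟨a, g, hg, h⟩ := ih
    obtain ⟨a', g', hg', h'⟩ := ih'
    exact ⟨a + a', g + g', add_mem hg hg', fun v x => by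
      simp only [Pi.add_apply, h, h', add_smul]; abel⟩
  | neg f _ ih =>
    obtain ⟨a, g, hg, h⟩ := ih
    exact ⟨-a, -g, neg_mem hg, fun v x => by
      simp only [Pi.neg_apply, h, neg_smul]; abel⟩

end Affine

section Elimination

variable {V : Type*} [AddCommGroup V] [LinearOrder V] [IsOrderedAddMonoid V]

/-- An affine function is bounded by a multiple of `z` on the box `[0, z)^ι`. -/
theorem exists_abs_le_of_mem_affine {ι : Type*} {z : V} (hz : ∀ c : V, ∃ N : ℕ, |c| ≤ N • z)
    {f : (ι → V) → V} (hf : f ∈ affine V ι) :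
    ∃ N : ℕ, ∀ v : ι → V, (∀ i, 0 ≤ v i ∧ v i < z) → |f v| ≤ N • z := by
  induction hf using AddSubgroup.closure_induction with
  | mem f hf =>
    rcases hf with ⟨i, rfl⟩ | ⟨c, rfl⟩
    · refine ⟨1, fun v hv => ?_⟩
      rw [one_smul, abs_of_nonneg (hv i).1]
      exact (hv i).2.le
    · obtain ⟨N, hN⟩ := hz c
      exact ⟨N, fun _ _ => hN⟩
  | zero => exact ⟨0, by simp⟩
  | add f f' _ _ ih ih' =>
    obtain ⟨N, h⟩ := ih
    obtain ⟨N', h'⟩ := ih'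
    refine ⟨N + N', fun v hv => (abs_add_le _ _).trans ?_⟩
    rw [add_smul]
    exact add_le_add (h v hv) (h' v hv)
  | neg f _ ih =>
    obtain ⟨N, h⟩ := ih
    exact ⟨N, fun v hv => by simpa using h v hv⟩

theorem sign_zsmul (a : ℤ) (u : V) : sign (a • u) = sign a * sign u := by
  rcases lt_trichotomy a 0 with ha | rfl | ha
  · rcases lt_trichotomy u 0 with hu | rfl | hu
    · rw [sign_neg ha, sign_neg hu, sign_pos (smul_pos_of_neg_of_neg ha hu)]; rfl
    · simp
    · rw [sign_neg ha, sign_pos hu, sign_neg (smul_neg_of_neg_of_pos ha hu)]; rfl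
  · simp
  · rcases lt_trichotomy u 0 with hu | rfl | hu
    · rw [sign_pos ha, sign_neg hu, sign_neg (smul_neg_of_pos_of_neg ha hu)]; rfl
    · simp
    · rw [sign_pos ha, sign_pos hu, sign_pos (smul_pos ha hu)]; rfl

/-- A back-and-forth step: `p` and `q` have the same order pattern, so density and the lack of
endpoints provide a point placed among the `q i` as `x` is among the `p i`. -/
theorem exists_sign_sub_eq [DenselyOrdered V] [NoMinOrder V] [NoMaxOrder V]
    {I : Type*} [Finite I] (p q : I → V)
    (h : ∀ i j, sign (p i - p j) = sign (q i - q j)) (x : V) :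
    ∃ y, ∀ i, sign (x - p i) = sign (y - q i) := by
  classical
  have := Fintype.ofFinite I
  by_cases hx : ∃ i, x = p i
  · obtain ⟨i, rfl⟩ := hx
    exact ⟨q i, fun j => h i j⟩
  · push Not at hx
    obtain ⟨y, hy, hy'⟩ := Order.exists_between_finsets
      (Finset.univ.filter (fun i => p i < x) |>.image q)
      (Finset.univ.filter (fun i => x < p i) |>.image q) (by
        intro s hs t ht
        simp only [Finset.mem_image, Finset.mem_filter, Finset.mem_univ, true_and] at hs ht
        obtain ⟨i, hi, rfl⟩ := hs
        obtain ⟨j, hj, rfl⟩ := ht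
        have := h i j
        rw [sign_neg (sub_neg.2 (hi.trans hj))] at this
        exact sub_neg.1 (sign_eq_neg_one_iff.1 this.symm))
    refine ⟨y, fun i => ?_⟩
    rcases lt_or_gt_of_ne (hx i) with hi | hi
    · rw [sign_neg (sub_neg.2 hi), sign_neg (sub_neg.2 (hy' _ (Finset.mem_image_of_mem _
        (Finset.mem_filter.2 ⟨Finset.mem_univ _, hi⟩))))]
    · rw [sign_pos (sub_pos.2 hi), sign_pos (sub_pos.2 (hy _ (Finset.mem_image_of_mem _
        (Finset.mem_filter.2 ⟨Finset.mem_univ _, hi⟩))))]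

/-- Elimination of one variable in a finite system of linear sign conditions over a divisible
ordered abelian group. -/
theorem exists_sign_eq_of_sign_eq [DenselyOrdered V] [NoMinOrder V] [NoMaxOrder V]
    (hdiv : ∀ a : ℤ, a ≠ 0 → ∀ x : V, ∃ y, a • y = x) {X : Type*}
    {P : Set (ℤ × (X → V))} (hP : P.Finite) {v w : X}
    (h : ∀ s ∈ P, sign (s.2 v) = sign (s.2 w))
    (h' : ∀ s ∈ P, ∀ t ∈ P,
      sign (s.1 • t.2 v - t.1 • s.2 v) = sign (s.1 • t.2 w - t.1 • s.2 w)) (x : V) :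
    ∃ y, ∀ s ∈ P, sign (s.1 • x + s.2 v) = sign (s.1 • y + s.2 w) := by
  let I := {s : ℤ × (X → V) // s ∈ P ∧ s.1 ≠ 0}
  have : Finite I := (hP.subset (fun s hs => hs.1 : {s | s ∈ P ∧ s.1 ≠ 0} ⊆ P)).to_subtype
  -- With `r` the root, `s.1 • x + s.2 u = s.1 • (x - r u s)`. Roots are compared through `s.1 • t.2
  -- u - t.1 • s.2 u = (s.1 * t.1) • (r u s - r u t)`, which is what `h'` controls.
  have hr : ∀ (u : X) (s : I), ∃ r : V, s.1.1 • r = - s.1.2 u := fun u s => hdiv _ s.2.2 _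
  choose r hr using hr
  obtain ⟨y, hy⟩ := exists_sign_sub_eq (r v) (r w) (fun s t => by
    have key : ∀ u, sign (s.1.1 * t.1.1) * sign (r u s - r u t) =
        sign (s.1.1 • t.1.2 u - t.1.1 • s.1.2 u) := by
      intro u
      rw [← sign_zsmul, smul_sub, mul_comm, mul_smul, hr, mul_comm, mul_smul, hr]
      congr 1
      simp only [smul_neg]
      abel
    have h1 := key v
    rw [h' s.1 s.2.1 t.1 t.2.1, ← key w] at h1
    exact mul_left_cancel₀ (by
      rw [Ne, sign_eq_zero_iff]; exact mul_ne_zero s.2.2 t.2.2) h1) x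
  refine ⟨y, fun s hs => ?_⟩
  by_cases hs0 : s.1 = 0
  · simpa [hs0] using h s hs
  · have key : ∀ u x, sign (s.1 • x + s.2 u) = sign s.1 * sign (x - r u ⟨s, hs, hs0⟩) := by
      intro u x
      rw [← sign_zsmul, smul_sub, hr u ⟨s, hs, hs0⟩, sub_neg_eq_add]
    rw [key, key, hy]

end Elimination

end CyclicallyOrderedGroup
-- Formulas as sign conditions on the box.
namespace CyclicallyOrderedGroup

open SignType FirstOrder

variable {G : Type*} [CommGroup G] {R : G → G → G → Prop}

namespace Unwound

variable {hR : IsCyclicOrder R}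

@[simp] theorem sub_pos_eq (x y : Unwound hR) : (x - y).pos = x.pos * y.pos⁻¹ := by
  rw [sub_eq_add_neg, add_pos, neg_pos]

/-- As `1` is least in the cut order, `k • turn hR` is the least element with `k` turns; `turns` is
thus the integer part with respect to `turn hR`. -/
theorem zsmul_turn_le_iff (k : ℤ) (x : Unwound hR) : k • turn hR ≤ x ↔ k ≤ x.turns := by
  rw [zsmul_turn, ← not_lt, lt_def]
  simp only
  constructor
  · intro h
    by_contra h'
    exact h (Or.inl (by omega))
  · rintro h (h' | h')
    · omega
    · exact hR.not_cutLT_one _ h'.2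

theorem turns_eq_zero_iff (x : Unwound hR) : x.turns = 0 ↔ 0 ≤ x ∧ x < turn hR := by
  have h0 := zsmul_turn_le_iff 0 x
  have h1 := zsmul_turn_le_iff 1 x
  rw [zero_smul] at h0
  rw [one_smul] at h1
  rw [← not_le, h0, h1]
  omega

theorem exists_abs_le (x : Unwound hR) : ∃ N : ℕ, |x| ≤ N • turn hR := by
  refine ⟨x.turns.natAbs + 1, abs_le.2 ⟨?_, ?_⟩⟩
  · rw [← natCast_zsmul, ← neg_smul, zsmul_turn_le_iff]
    omega
  · rw [← natCast_zsmul]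
    refine le_of_lt (not_le.1 fun h => ?_)
    rw [zsmul_turn_le_iff] at h
    omega

theorem turns_eq_of_sign_eq {x y : Unwound hR}
    (h : ∀ k : ℤ, sign (x - k • turn hR) = sign (y - k • turn hR)) : x.turns = y.turns := by
  have key : ∀ k : ℤ, k ≤ x.turns ↔ k ≤ y.turns := by
    intro k
    rw [← zsmul_turn_le_iff, ← zsmul_turn_le_iff, ← sub_nonneg, ← sub_nonneg (a := y),
      ← not_lt, ← not_lt, ← sign_eq_neg_one_iff, ← sign_eq_neg_one_iff, h]
  exact le_antisymm ((key _).1 le_rfl) ((key _).2 le_rfl)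

theorem pos_eq_one_iff (x : Unwound hR) : x.pos = 1 ↔ ∃ k : ℤ, sign (x - k • turn hR) = 0 := by
  simp only [sign_eq_zero_iff, sub_eq_zero, zsmul_turn]
  exact ⟨fun h => ⟨x.turns, Unwound.ext rfl h⟩, fun ⟨k, hk⟩ => by rw [hk]⟩

theorem cutLT_pos_iff (x y : Unwound hR) :
    CutLT R x.pos y.pos ↔ sign (x - y - (x.turns - y.turns) • turn hR) = -1 := by
  rw [sign_eq_neg_one_iff, sub_sub, sub_neg, add_zsmul_turn, lt_def]
  simp

/-- Translation moves the first point to `1`, where `R 1` is the cut order away from its least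
element. -/
theorem cyc_pos_iff (x y z : Unwound hR) :
    R x.pos y.pos z.pos ↔ (y - x).pos ≠ 1 ∧ CutLT R (y - x).pos (z - x).pos := by
  have h1 : R x.pos y.pos z.pos ↔ R 1 (y - x).pos (z - x).pos := by
    constructor
    · intro h
      have := hR.mul_left x.pos⁻¹ h
      simpa [mul_comm] using this
    · intro h
      have := hR.mul_left x.pos h
      simpa [mul_comm] using this
  rw [h1]
  constructor
  · exact fun h => ⟨(hR.strict _ _ _ h).1.symm, Or.inr h⟩
  · rintro ⟨h, h'⟩
    exact h'.resolve_left fun H => h H.1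

end Unwound

open Unwound

section

variable {hR : IsCyclicOrder R} {ι : Type*}

/-- On the box `|f| ≤ N • turn`, so for `|k| > N` the sign of `f - k • turn` is constant; only `-N ≤
k ≤ N` need be recorded. -/
theorem exists_finite_sign_sub_zsmul_turn {f : (ι → Unwound hR) → Unwound hR}
    (hf : f ∈ affine (Unwound hR) ι) :
    ∃ F : Set ((ι → Unwound hR) → Unwound hR), F.Finite ∧ F ⊆ affine (Unwound hR) ι ∧
      ∀ v w : ι → Unwound hR, (∀ i, (v i).turns = 0) → (∀ i, (w i).turns = 0) →
        (∀ f ∈ F, sign (f v) = sign (f w)) →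
        ∀ k : ℤ, sign (f v - k • turn hR) = sign (f w - k • turn hR) := by
  obtain ⟨N, hN⟩ := exists_abs_le_of_mem_affine exists_abs_le hf
  simp only [← turns_eq_zero_iff] at hN
  refine ⟨(fun k : ℤ => f - fun _ => k • turn hR) '' Set.Icc (-N : ℤ) N,
    (Set.finite_Icc _ _).image _, ?_, fun v w hv hw h k => ?_⟩
  · rintro _ ⟨k, _, rfl⟩
    exact sub_mem hf (const_mem_affine _)
  · by_cases hk : k ∈ Set.Icc (-N : ℤ) N
    · exact h _ ⟨k, hk, rfl⟩
    · have hv := abs_le.1 (hN v hv)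
      have hw := abs_le.1 (hN w hw)
      rw [← natCast_zsmul, ← neg_smul] at hv hw
      rw [Set.mem_Icc, not_and_or, not_le, not_le] at hk
      rcases hk with hk | hk
      · have := zsmul_lt_zsmul_left (turn_pos (hR := hR)) hk
        rw [sign_pos (sub_pos.2 (this.trans_le hv.1)), sign_pos (sub_pos.2 (this.trans_le hw.1))]
      · have := zsmul_lt_zsmul_left (turn_pos (hR := hR)) hk
        rw [sign_neg (sub_neg.2 (hv.2.trans_lt this)), sign_neg (sub_neg.2 (hw.2.trans_lt this))]

theorem exists_affine_pos_eq_realize (t : lang.Term ι) :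
    letI := toStructure R
    ∃ f ∈ affine (Unwound hR) ι, ∀ v, (f v).pos = t.realize fun i => (v i).pos := by
  let _ := toStructure R
  induction t with
  | var i => exact ⟨_, coord_mem_affine i, fun v => rfl⟩
  | func s ts ih =>
    choose f hf h using ih
    cases s with
    | mul => exact ⟨f 0 + f 1, add_mem (hf 0) (hf 1), fun v => by
        change (f 0 v).pos * (f 1 v).pos = _; rw [h, h]; rfl⟩
    | inv => exact ⟨-f 0, neg_mem (hf 0), fun v => by
        change (f 0 v).pos⁻¹ = _; rw [h]; rfl⟩
    | one => exact ⟨0, zero_mem _, fun v => rfl⟩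

end

/-- Quantifier elimination: the truth of a formula at a point of the box depends only on the signs
of finitely many affine functions. -/
theorem exists_finite_realize_iff {hR : IsCyclicOrder R}
    (hdiv : ∀ a : ℤ, a ≠ 0 → ∀ x : Unwound hR, ∃ y, a • y = x) {α : Type*} {n : ℕ}
    (φ : lang.BoundedFormula α n) :
    letI := toStructure R
    ∃ F : Set ((α ⊕ Fin n → Unwound hR) → Unwound hR), F.Finite ∧
      F ⊆ affine (Unwound hR) (α ⊕ Fin n) ∧
      ∀ v w : α ⊕ Fin n → Unwound hR, (∀ i, (v i).turns = 0) → (∀ i, (w i).turns = 0) →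
        (∀ f ∈ F, sign (f v) = sign (f w)) →
        (φ.Realize (fun i => (v (.inl i)).pos) (fun i => (v (.inr i)).pos) →
          φ.Realize (fun i => (w (.inl i)).pos) (fun i => (w (.inr i)).pos)) := by
  let _ := toStructure R
  have helim : ∀ {n : ℕ} (v : α ⊕ Fin n → Unwound hR),
      Sum.elim (fun i => (v (.inl i)).pos) (fun i => (v (.inr i)).pos) = fun i => (v i).pos := by
    intro n v; ext i; cases i <;> rfl
  induction φ with
  | falsum => exact ⟨∅, Set.finite_empty, Set.empty_subset _, fun v w _ _ _ h => h⟩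
  | equal t₁ t₂ =>
    obtain ⟨f₁, hf₁, h₁⟩ := exists_affine_pos_eq_realize (hR := hR) t₁
    obtain ⟨f₂, hf₂, h₂⟩ := exists_affine_pos_eq_realize (hR := hR) t₂
    obtain ⟨F, hF, hFa, h⟩ := exists_finite_sign_sub_zsmul_turn (sub_mem hf₁ hf₂)
    refine ⟨F, hF, hFa, fun v w hv hw hvw => ?_⟩
    have key : ∀ v, t₁.realize (fun i => (v i).pos) = t₂.realize (fun i => (v i).pos) ↔
        ((f₁ - f₂) v).pos = 1 := by
      intro v
      rw [← h₁, ← h₂, Pi.sub_apply, sub_pos_eq, mul_inv_eq_one]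
    change t₁.realize (Sum.elim _ _) = t₂.realize (Sum.elim _ _) →
      t₁.realize (Sum.elim _ _) = t₂.realize (Sum.elim _ _)
    rw [helim, helim, key, key, pos_eq_one_iff, pos_eq_one_iff]
    rintro ⟨k, hk⟩
    exact ⟨k, h v w hv hw hvw k ▸ hk⟩
  | rel r ts =>
    cases r
    have := fun i => exists_affine_pos_eq_realize (hR := hR) (ts i)
    choose f hf h using this
    obtain ⟨F₁, hF₁, hFa₁, h₁⟩ := exists_finite_sign_sub_zsmul_turn (sub_mem (hf 1) (hf 0))
    obtain ⟨F₂, hF₂, hFa₂, h₂⟩ := exists_finite_sign_sub_zsmul_turn (sub_mem (hf 2) (hf 0))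
    obtain ⟨F₃, hF₃, hFa₃, h₃⟩ := exists_finite_sign_sub_zsmul_turn
      (sub_mem (sub_mem (hf 1) (hf 0)) (sub_mem (hf 2) (hf 0)))
    refine ⟨F₁ ∪ F₂ ∪ F₃, (hF₁.union hF₂).union hF₃,
      Set.union_subset (Set.union_subset hFa₁ hFa₂) hFa₃, fun v w hv hw hvw => ?_⟩
    have key : ∀ v : α ⊕ Fin _ → Unwound hR, (R ((ts 0).realize (fun i => (v i).pos)) ((ts 1).realize (fun i => (v i).pos))
        ((ts 2).realize (fun i => (v i).pos)) ↔ (f 1 v - f 0 v).pos ≠ 1 ∧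
          CutLT R (f 1 v - f 0 v).pos (f 2 v - f 0 v).pos) := fun v => by
      rw [← h, ← h, ← h]; exact cyc_pos_iff (f 0 v) (f 1 v) (f 2 v)
    change R ((ts 0).realize _) ((ts 1).realize _) ((ts 2).realize _) →
      R ((ts 0).realize _) ((ts 1).realize _) ((ts 2).realize _)
    rw [helim, helim, key, key]
    have h₁ := h₁ v w hv hw fun f hf => hvw f (Or.inl (Or.inl hf))
    have h₂ := h₂ v w hv hw fun f hf => hvw f (Or.inl (Or.inr hf))
    have h₃ := h₃ v w hv hw fun f hf => hvw f (Or.inr hf)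
    simp only [Pi.sub_apply] at h₁ h₂ h₃
    rw [Ne, Ne, pos_eq_one_iff, pos_eq_one_iff, cutLT_pos_iff, cutLT_pos_iff]
    simp only [h₁, h₃, turns_eq_of_sign_eq h₁, turns_eq_of_sign_eq h₂]
    exact id
  | imp φ ψ ih₁ ih₂ =>
    obtain ⟨F₁, hF₁, hFa₁, h₁⟩ := ih₁
    obtain ⟨F₂, hF₂, hFa₂, h₂⟩ := ih₂
    refine ⟨F₁ ∪ F₂, hF₁.union hF₂, Set.union_subset hFa₁ hFa₂, fun v w hv hw hvw H H' => ?_⟩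
    -- The premise of an implication is contravariant, hence `v` and `w` are exchanged for it.
    exact h₂ v w hv hw (fun f hf => hvw f (Or.inr hf))
      (H (h₁ w v hw hv (fun f hf => (hvw f (Or.inl hf)).symm) H'))
  | @all n φ ih =>
    obtain ⟨F, hF, hFa, h⟩ := ih
    let V := Unwound hR
    have : Nontrivial V := ⟨0, turn hR, turn_pos.ne⟩
    have : DenselyOrdered V := ⟨fun a b hab => by
      obtain ⟨y, hy⟩ := hdiv 2 two_ne_zero (a + b)
      rw [two_smul] at hy
      refine ⟨y, ?_, ?_⟩
      · by_contra! H
        exact absurd hy ((add_le_add H H).trans_lt (by gcongr)).ne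
      · by_contra! H
        exact absurd hy (lt_of_lt_of_le (by gcongr) (add_le_add H H)).ne'⟩
    let e : (α ⊕ Fin n → V) → V → (α ⊕ Fin (n + 1) → V) := fun v x =>
      Sum.elim (fun i => v (.inl i)) (Fin.snoc (α := fun _ => V) (fun i => v (.inr i)) x)
    have he : ∀ i, (∃ j, ∀ v x, e v x i = v j) ∨ ∀ v x, e v x i = x := by
      rintro (i | i)
      · exact Or.inl ⟨.inl i, fun v x => rfl⟩
      · induction i using Fin.lastCases with
        | last => exact Or.inr fun v x => by simp [e]
        | cast i => exact Or.inl ⟨.inr i, fun v x => by simp [e]⟩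
    have hbox : ∀ v x, (∀ i, (v i).turns = 0) → x.turns = 0 → ∀ i, (e v x i).turns = 0 := by
      intro v x hv hx i
      rcases he i with ⟨j, hj⟩ | hj
      · rw [hj, hv]
      · rw [hj, hx]
    have hsep : ∀ f : F, ∃ s : ℤ × ((α ⊕ Fin n → V) → V),
        s.2 ∈ affine V (α ⊕ Fin n) ∧ ∀ v x, f.1 (e v x) = s.1 • x + s.2 v := by
      intro f
      obtain ⟨a, g, hg, hag⟩ := exists_zsmul_add_of_mem_affine e he (hFa f.2)
      exact ⟨(a, g), hg, hag⟩
    choose s hs hsf using hsep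
    have := hF.to_subtype
    -- The two extra conditions, the signs of `x` and `x - turn`, force the witness produced by
    -- elimination to stay in the box.
    let P : Set (ℤ × ((α ⊕ Fin n → V) → V)) :=
      Set.range s ∪ {(1, 0), (1, fun _ => -turn hR)}
    have hP : P.Finite := (Set.finite_range s).union (by simp)
    have hPa : ∀ p ∈ P, p.2 ∈ affine V (α ⊕ Fin n) := by
      rintro p (⟨f, rfl⟩ | rfl | rfl)
      · exact hs f
      · exact zero_mem _
      · exact const_mem_affine _
    refine ⟨Prod.snd '' P ∪ (fun q : _ × _ => q.1.1 • q.2.2 - q.2.1 • q.1.2) '' (P ×ˢ P),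
      (hP.image _).union ((hP.prod hP).image _), ?_, fun v w hv hw hvw H y' => ?_⟩
    · rintro _ (⟨p, hp, rfl⟩ | ⟨⟨p, q⟩, ⟨hp, hq⟩, rfl⟩)
      · exact hPa p hp
      · exact sub_mem (zsmul_mem (hPa q hq) _) (zsmul_mem (hPa p hp) _)
    · obtain ⟨x, hx⟩ := exists_sign_eq_of_sign_eq hdiv hP (v := w) (w := v)
        (fun p hp => (hvw _ (Or.inl ⟨p, hp, rfl⟩)).symm)
        (fun p hp q hq => (hvw _ (Or.inr ⟨(p, q), ⟨hp, hq⟩, rfl⟩)).symm) ⟨0, y'⟩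
      have hxt : x.turns = 0 := by
        have h1 := hx (1, 0) (by simp [P])
        have h2 := hx (1, fun _ => -turn hR) (by simp [P])
        have h3 := (turns_eq_zero_iff (⟨0, y'⟩ : V)).1 rfl
        simp only [one_smul, Pi.zero_apply, add_zero, ← sub_eq_add_neg] at h1 h2
        rw [turns_eq_zero_iff]
        refine ⟨not_lt.1 fun h => ?_, ?_⟩
        · rw [sign_neg h, sign_eq_neg_one_iff] at h1
          exact h3.1.not_gt h1
        · rw [sign_neg (sub_neg.2 h3.2)] at h2
          exact sub_neg.1 (sign_eq_neg_one_iff.1 h2.symm)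
      have hsnoc : ∀ (v : α ⊕ Fin n → V) (x : V),
          (fun i => (e v x (.inr i)).pos) = Fin.snoc (fun i => (v (.inr i)).pos) x.pos := by
        intro v x
        ext i
        induction i using Fin.lastCases with
        | last => simp [e]
        | cast i => simp [e]
      have := h (e v x) (e w ⟨0, y'⟩) (hbox _ _ hv hxt) (hbox _ _ hw rfl) (fun f hf => by
        rw [show f = (⟨f, hf⟩ : F).1 from rfl, hsf, hsf]
        exact (hx _ (Or.inl ⟨_, rfl⟩)).symm)
      rw [hsnoc, hsnoc] at this
      exact this (H x.pos)

end CyclicallyOrderedGroup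
-- From cut points to intervals.
namespace CyclicallyOrderedGroup

open SignType FirstOrder

variable {G : Type*} [CommGroup G] {R : G → G → G → Prop}

/-- A set whose membership depends only on the position relative to finitely many cut points is a
finite union of singletons and open intervals. -/
theorem IsCyclicOrder.exists_finite_sUnion_eq (hR : IsCyclicOrder R) {S P : Set G} (hP : P.Finite)
    (h1 : 1 ∈ P) {p₁ : G} (hp₁ : p₁ ∈ P) (hne : p₁ ≠ 1)
    (h : ∀ x y, x ∉ P → y ∉ P → (∀ p ∈ P, CutLT R p x ↔ CutLT R p y) → x ∈ S → y ∈ S) :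
    ∃ F : Set (Set G), F.Finite ∧
      (∀ J ∈ F, (∃ g : G, J = {g}) ∨ IsOpenInterval R J) ∧ S = ⋃₀ F := by
  let _ := hR.cutOrder
  have e : ∀ x y : G, CutLT R x y ↔ x < y := fun _ _ => Iff.rfl
  refine ⟨((fun p => {p}) '' (P ∩ S)) ∪
    ((fun q : G × G => interval R q.1 q.2) '' {q | q ∈ P ×ˢ P ∧ q.1 ≠ q.2 ∧
      interval R q.1 q.2 ⊆ S}),
    ((hP.subset Set.inter_subset_left).image _).union
      (((hP.prod hP).subset fun q hq => hq.1).image _), ?_, ?_⟩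
  · rintro _ (⟨p, _, rfl⟩ | ⟨q, hq, rfl⟩)
    · exact Or.inl ⟨p, rfl⟩
    · exact Or.inr ⟨q.1, q.2, hq.2.1, rfl⟩
  · apply Set.Subset.antisymm
    · intro x hx
      by_cases hxP : x ∈ P
      · exact ⟨{x}, Or.inl ⟨x, ⟨hxP, hx⟩, rfl⟩, rfl⟩
      have hneP : ∀ p ∈ P, p ≠ x := fun p hp hpx => hxP (hpx ▸ hp)
      obtain ⟨p, ⟨hpP, hpx⟩, hpmax⟩ := Set.exists_max_image {p ∈ P | p < x} id
        (hP.subset fun _ h => h.1) ⟨1, h1, IsCyclicOrder.one_cutLT (hneP 1 h1).symm⟩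
      -- `p'` is the next cut point after `x`, or `1` when there is none and the interval wraps
      -- around to the origin.
      have main : ∃ p' ∈ P, R p x p' ∧
          ∀ y, R p y p' → p < y ∧ ∀ q ∈ P, x < q → y < q := by
        by_cases hq : ∃ q ∈ P, x < q
        · obtain ⟨p', ⟨hpP', hpx'⟩, hpmin⟩ := Set.exists_min_image {p ∈ P | x < p} id
            (hP.subset fun _ h => h.1) (by obtain ⟨q, hq⟩ := hq; exact ⟨q, hq⟩)
          refine ⟨p', hpP', hR.cyc_of_cutLT hpx hpx', fun y hy => ?_⟩
          have := hR.cutLT_chain_of hy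
          simp only [e] at this
          have hpp : p < p' := hpx.trans hpx'
          have h3 : p < y ∧ y < p' := by
            rcases this with h | h | h
            · exact h
            · exact absurd hpp h.2.not_gt
            · exact absurd hpp h.1.not_gt
          exact ⟨h3.1, fun q hq hxq => h3.2.trans_le (hpmin q ⟨hq, hxq⟩)⟩
        · push Not at hq
          -- The second cut point `p₁` matters here: without it the arc after the last cut point
          -- could have both ends equal to `1`.
          have hp1 : p ≠ 1 := by
            rintro rfl
            have h3 : p₁ < x := lt_of_le_of_ne (hq p₁ hp₁) (hneP _ hp₁)
            have h4 : p₁ ≤ 1 := hpmax p₁ ⟨hp₁, h3⟩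
            exact h4.not_gt (IsCyclicOrder.one_cutLT hne)
          refine ⟨1, h1, ?_, fun y hy => ?_⟩
          · exact hR.cyclic _ _ _ (hR.cyc_of_cutLT (IsCyclicOrder.one_cutLT hp1) hpx)
          · refine ⟨?_, fun q hqP hxq => absurd hxq (hq q hqP).not_gt⟩
            rcases hR.cutLT_chain_of hy with h3 | h3 | h3
            · exact h3.1
            · exact absurd h3.1 (hR.not_cutLT_one _)
            · exact h3.2
      obtain ⟨p', hpP', hx', hy⟩ := main
      refine ⟨_, Or.inr ⟨(p, p'), ⟨⟨hpP, hpP'⟩, (hR.strict _ _ _ hx').2.2.symm, ?_⟩, rfl⟩, hx'⟩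
      intro y hyI
      obtain ⟨hpy, hyq⟩ := hy y hyI
      refine h x y hxP (fun hyP => ?_) (fun q hqP => ?_) hx
      · rcases lt_or_gt_of_ne (hneP y hyP) with h3 | h3
        · exact (hpmax y ⟨hyP, h3⟩).not_gt hpy
        · exact lt_irrefl _ (hyq y hyP h3)
      · rw [e, e]
        refine ⟨fun h3 => lt_of_le_of_lt (hpmax q ⟨hqP, h3⟩) hpy, fun h3 => ?_⟩
        exact (lt_or_gt_of_ne (hneP q hqP)).resolve_right fun h4 => (hyq q hqP h4).not_gt h3
    · rintro x ⟨_, ⟨p, hp, rfl⟩ | ⟨q, hq, rfl⟩, hx⟩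
      · rw [Set.mem_singleton_iff.1 hx]; exact hp.2
      · exact hq.2.2 hx

/-! ### Divisibility of the unwound group and the conclusion. -/

namespace Unwound

/-- Let `ζ` be the image of `exp (2πi/n)`. The powers `1, ζ, …, ζ ^ (n - 1)` increase in the cut
order, so no carry occurs until the last multiplication returns to `1` and adds exactly one turn. -/
theorem exists_nsmul_eq_turn (hR : IsCyclicOrder R) (ht : ContainsTorsionCircle R) {n : ℕ}
    (hn : n ≠ 0) : ∃ w : Unwound hR, n • w = turn hR := by
  obtain ⟨m, rfl | rfl⟩ : ∃ m, n = 1 ∨ n = m + 2 :=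
    ⟨n - 2, by omega⟩
  · exact ⟨turn hR, one_smul _ _⟩
  obtain ⟨H, f, hf⟩ := ht
  set n := m + 2 with hnm
  set θ : ℝ := 2 * Real.pi / n with hθ
  have hn0 : (0 : ℝ) < n := by rw [hnm]; positivity
  have hnθ : n * θ = 2 * Real.pi := by rw [hθ]; field_simp
  have hθ0 : 0 < θ := by positivity
  have hpow : ∀ k : ℕ, Circle.exp θ ^ k = Circle.exp (k * θ) := by
    intro k
    rw [← nsmul_eq_mul, Circle.exp_nsmul]
  have hn1 : Circle.exp θ ^ n = 1 := by rw [hpow, hnθ, Circle.exp_two_pi]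
  let t : CommGroup.torsion Circle :=
    ⟨Circle.exp θ, isOfFinOrder_iff_pow_eq_one.2 ⟨n, by omega, hn1⟩⟩
  have htn : t ^ n = 1 := Subtype.ext hn1
  let ζ : G := f t
  have hζ : ∀ k : ℕ, ζ ^ k = f (t ^ k) := by intro k; simp [ζ]
  have hζn : ζ ^ n = 1 := by rw [hζ, htn]; simp
  have ht1 : t ≠ 1 := by
    intro h
    have h : Circle.exp θ = 1 := congrArg Subtype.val h
    rw [Circle.exp_eq_one] at h
    obtain ⟨k, hk⟩ := h
    have hn2 : (2 : ℝ) ≤ n := by rw [hnm]; push_cast; linarith [(Nat.cast_nonneg m : (0:ℝ) ≤ m)]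
    have hpi := Real.pi_pos
    have h1 : (n : ℝ) * k = 1 := by
      have : (n * k : ℝ) * (2 * Real.pi) = 1 * (2 * Real.pi) := by
        rw [← hnθ.trans (one_mul _).symm, hk]; ring
      exact mul_right_cancel₀ (by positivity) this
    have h2 : (n : ℤ) * k = 1 := by exact_mod_cast h1
    have h3 := Int.isUnit_iff.1 (IsUnit.of_mul_eq_one _ h2)
    omega
  have hζ1 : ζ ≠ 1 := by
    intro h
    exact ht1 (f.injective (Subtype.ext (by rw [map_one]; exact h)))
  have hlt : ∀ k : ℕ, k + 1 < n → ¬ CutLT R (ζ ^ k * ζ) (ζ ^ k) := by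
    intro k hk H
    rcases Nat.eq_zero_or_pos k with rfl | hk0
    · rw [pow_zero] at H
      exact hR.not_cutLT_one _ H
    · have h3 : R 1 (ζ ^ k) (ζ ^ (k + 1)) := by
        have := (hf 1 (t ^ k) (t ^ (k + 1))).1 ⟨0, k * θ, (k + 1 : ℕ) * θ, by simp, hpow k,
          hpow (k + 1), Or.inl ⟨le_rfl, by positivity, by
            gcongr; omega, by rw [← hnθ]; gcongr⟩⟩
        rw [hζ, hζ]
        simpa using this
      rw [← pow_succ] at H
      exact hR.cutLT_irrefl _ (hR.cutLT_trans H (Or.inr h3))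
  have key : ∀ k : ℕ, k < n → k • (⟨0, ζ⟩ : Unwound hR) = ⟨0, ζ ^ k⟩ := by
    intro k hk
    induction k with
    | zero => simp; rfl
    | succ k ih =>
      rw [succ_nsmul, ih (by omega)]
      ext
      · simp [add_turns, IsCyclicOrder.carry_of_not_cutLT (hlt k hk)]
      · simp [pow_succ]
  have hlast : ζ ^ (m + 1) * ζ = 1 := by rw [← pow_succ]; exact hζn
  have hc : CutLT R (ζ ^ (m + 1) * ζ) (ζ ^ (m + 1)) := by
    rw [hlast]
    refine IsCyclicOrder.one_cutLT fun h => hζ1 ?_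
    rw [h, one_mul] at hlast
    exact hlast
  refine ⟨⟨0, ζ⟩, ?_⟩
  rw [hnm, succ_nsmul, key (m + 1) (by omega)]
  ext
  · simp [add_turns, IsCyclicOrder.carry_of_cutLT hc, turn]
  · simpa [turn] using hlast

/-- A root of `x.pos` in `G` lifts to a root of `x` up to a multiple of `turn`, corrected by that
multiple of a root of `turn`. -/
theorem exists_zsmul_eq (hR : IsCyclicOrder R) (hdiv : IsCDivisible R) {a : ℤ} (ha : a ≠ 0)
    (x : Unwound hR) : ∃ y, a • y = x := by
  have key : ∀ n : ℕ, n ≠ 0 → ∃ y, n • y = x := by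
    intro n hn
    obtain ⟨h, hh⟩ := hdiv.1 n hn x.pos
    obtain ⟨w, hw⟩ := exists_nsmul_eq_turn hR hdiv.2 hn
    have hpos : ∀ k : ℕ, (k • (⟨0, h⟩ : Unwound hR)).pos = h ^ k := by
      intro k
      induction k with
      | zero => simp
      | succ k ih => rw [succ_nsmul, add_pos, ih, pow_succ]
    refine ⟨⟨0, h⟩ + (x.turns - (n • (⟨0, h⟩ : Unwound hR)).turns) • w, ?_⟩
    rw [smul_add, smul_comm n, hw, add_zsmul_turn, hpos, hh]
    ext <;> simp
  obtain ⟨n, rfl | rfl⟩ := a.eq_nat_or_neg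
  · obtain ⟨y, hy⟩ := key n (by simpa using ha)
    exact ⟨y, by simpa using hy⟩
  · obtain ⟨y, hy⟩ := key n (by simpa using ha)
    exact ⟨-y, by simpa using hy⟩

end Unwound

open Unwound

/-- If `G` were trivial, a half of `turn` would be an integer multiple of `turn`. -/
theorem IsCDivisible.exists_ne_one (hR : IsCyclicOrder R) (hdiv : IsCDivisible R) :
    ∃ g : G, g ≠ 1 := by
  obtain ⟨w, hw⟩ := exists_nsmul_eq_turn hR hdiv.2 two_ne_zero
  refine ⟨w.pos, fun h => ?_⟩
  have : w = w.turns • turn hR := by rw [zsmul_turn]; exact Unwound.ext rfl h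
  rw [this] at hw
  have := congrArg Unwound.turns hw
  rw [← natCast_zsmul, smul_smul, zsmul_turn] at this
  simp only [turn] at this
  omega

theorem IsCDivisible.infinite (hR : IsCyclicOrder R) (hdiv : IsCDivisible R) : Infinite G := by
  obtain ⟨g, hg⟩ := hdiv.exists_ne_one hR
  by_contra H
  have := not_infinite_iff_finite.1 H
  obtain ⟨h, hh⟩ := hdiv.1 (Nat.card G) Nat.card_pos.ne' g
  exact hg (by rw [← hh, pow_card_eq_one'])

theorem IsCDivisible.exists_finite_sUnion_eq (hR : IsCyclicOrder R) (hdiv : IsCDivisible R)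
    {S : Set G} (hS : IsDefinable R S) :
    ∃ F : Set (Set G), F.Finite ∧
      (∀ J ∈ F, (∃ g : G, J = {g}) ∨ IsOpenInterval R J) ∧ S = ⋃₀ F := by
  let _ := toStructure R
  let V := Unwound hR
  have hV : ∀ a : ℤ, a ≠ 0 → ∀ x : V, ∃ y, a • y = x := fun a ha => exists_zsmul_eq hR hdiv ha
  obtain ⟨φ, hφ⟩ := Set.definable_iff_exists_formula_sum.1 hS
  obtain ⟨F, hF, hFa, hFφ⟩ := exists_finite_realize_iff hV φ
  let e : (↥(Set.univ : Set G) → V) → V → (((Set.univ : Set G) ⊕ Fin 1) ⊕ Fin 0 → V) :=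
    fun v x => Sum.elim (Sum.elim v fun _ => x) Fin.elim0
  have he : ∀ i, (∃ j, ∀ v x, e v x i = v j) ∨ ∀ v x, e v x i = x := by
    rintro ((i | i) | i)
    · exact Or.inl ⟨i, fun v x => rfl⟩
    · exact Or.inr fun v x => rfl
    · exact i.elim0
  let c : ↥(Set.univ : Set G) → V := fun g => ⟨0, g⟩
  have hbox : ∀ (x : G) i, (e c ⟨0, x⟩ i).turns = 0 := by
    intro x i
    rcases he i with ⟨j, hj⟩ | hj <;> rw [hj]
  have hmem : ∀ x : G, x ∈ S ↔ φ.Realize (fun i => (e c ⟨0, x⟩ (.inl i)).pos) := by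
    intro x
    have := Set.ext_iff.1 hφ fun _ => x
    refine this.trans (Iff.of_eq ?_)
    change φ.Realize _ = _
    congr 1
    ext i
    rcases i with i | i <;> rfl
  -- In the single variable `x`, each `f` is `a • x` plus a constant: its sign is constant or is
  -- governed by one root `r`.
  have hroot : ∀ f : F, ∃ r : V, ∃ a : ℤ, ∃ b : SignType,
      ∀ x, sign (f.1 (e c x)) = if a = 0 then b else sign a * sign (x - r) := by
    intro f
    obtain ⟨a, g, -, hag⟩ := exists_zsmul_add_of_mem_affine e he (hFa f.2)
    by_cases ha : a = 0
    · exact ⟨0, a, sign (g c), fun x => by rw [hag, if_pos ha, ha, zero_smul, zero_add]⟩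
    · obtain ⟨r, hr⟩ := hV a ha (- g c)
      refine ⟨r, a, 0, fun x => ?_⟩
      rw [if_neg ha, hag, ← sign_zsmul, smul_sub, hr, sub_neg_eq_add]
  choose r a b hr using hroot
  have := hF.to_subtype
  obtain ⟨p₁, hp₁⟩ := hdiv.exists_ne_one hR
  refine hR.exists_finite_sUnion_eq (P := {1, p₁} ∪ Set.range fun f => (r f).pos)
    ((by simp : ({1, p₁} : Set G).Finite).union (Set.finite_range _)) (by simp) (p₁ := p₁)
    (by simp) hp₁ fun x y hx hy hxy hxS => ?_
  rw [hmem] at hxS ⊢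
  have hdef : ∀ x : G, (fun i : Fin 0 => (e c ⟨0, x⟩ (.inr i)).pos) = default :=
    fun x => Subsingleton.elim _ _
  have := hFφ (e c ⟨0, x⟩) (e c ⟨0, y⟩) (hbox x) (hbox y) (fun f hf => by
    rw [show f = (⟨f, hf⟩ : F).1 from rfl, hr, hr]
    set s := r ⟨f, hf⟩ with hs
    have hsP : s.pos ∈ {1, p₁} ∪ Set.range fun f => (r f).pos := Or.inr ⟨_, rfl⟩
    have hpos : ∀ {z : G}, CutLT R s.pos z → s.turns = 0 →
        sign ((⟨0, z⟩ : V) - s) = 1 := fun h h' =>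
      sign_pos (sub_pos.2 (Or.inr ⟨h', h⟩))
    have hneg : ∀ {z : G}, z ≠ s.pos → ¬ CutLT R s.pos z → s.turns = 0 →
        sign ((⟨0, z⟩ : V) - s) = -1 := fun hz h h' =>
      sign_neg (sub_neg.2 (Or.inr ⟨h'.symm,
        ((hR.cutLT_trichotomy _ _).resolve_right (by rintro (h2 | h2); exacts [hz h2, h h2]))⟩))
    have hxs : x ≠ s.pos := fun h => hx (h ▸ hsP)
    have hys : y ≠ s.pos := fun h => hy (h ▸ hsP)
    congr 2
    -- A root off the sheet of zero turns lies on one side of the whole box, so only roots on that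
    -- sheet really cut it.
    rcases lt_trichotomy s.turns 0 with h | h | h
    · rw [sign_pos (sub_pos.2 (Or.inl h)), sign_pos (sub_pos.2 (Or.inl h))]
    · by_cases h3 : CutLT R s.pos x
      · rw [hpos h3 h, hpos ((hxy _ hsP).1 h3) h]
      · rw [hneg hxs h3 h, hneg hys (fun h4 => h3 ((hxy _ hsP).2 h4)) h]
    · rw [sign_neg (sub_neg.2 (Or.inl h)), sign_neg (sub_neg.2 (Or.inl h))])
  rw [hdef, hdef] at this
  exact this hxS

end CyclicallyOrderedGroup

theorem proposition5p1 {G : Type*} [CommGroup G] (R : G → G → G → Prop)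
    (hR : CyclicallyOrderedGroup.IsCyclicOrder R)
    (hdiv : CyclicallyOrderedGroup.IsCDivisible R) :
    CyclicallyOrderedGroup.IsCyclicallyMinimal R :=
  ⟨hdiv.infinite hR, fun _ hS => hdiv.exists_finite_sUnion_eq hR hS⟩
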